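/- Let $H$ be a complex Hilbert space and $\mathcal M\subset\mathcal B(H)$ a von Neumann algebra with commutant $\mathcal M'$. A \emph{quantum relation} on $\mathcal M\subset\mathcal B(H)$ is a weak*-closed linear subspace $\mathcal V\subset\mathcal B(H)$ with $\mathcal M'\mathcal V\subset\mathcal V$ and $\mathcal V\mathcal M'\subset\mathcal V$. A \emph{quantum coarse structure} on $\mathcal M\subset\mathcal B(H)$ is a family $\mathscr V$ of quantum relations on $\mathcal M\subset\mathcal B(H)$ such that $\mathcal M'\in\mathscr V$; every quantum relation contained in a member of $\mathscr V$ belongs to $\mathscr V$; and for all $\mathcal V_1,\mathcal V_2\in\mathscr V$ the sets $\mathcal V_1^*$ (the adjoints of the elements of $\mathcal V_1$), $\overline{\mathcal V_1+\mathcal V_2}^{\,w^*}$ and $\overline{\mathrm{span}}^{\,w^*}(\mathcal V_1\mathcal V_2)$ belong to $\mathscr V$. Its \emph{quantum uniform Roe algebra} is the norm closure of $\bigcup_{\mathcal V\in\mathscr V}\mathcal V$. For $\xi\in H$ let $s^{\mathcal M}(\xi)$ be the smallest projection in $\mathcal M$ that fixes $\xi$. Given a faithful normal semifinite trace $\tau$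 on $\mathcal M$, the \emph{vector support expansion C*-algebra} of $(\mathcal M\subset\mathcal B(H),\tau)$ is the norm closure of the set of all $a\in\mathcal B(H)$ for which there is $\lambda\in[0,\infty)$ with $$\tau(s^{\mathcal M}(a\xi))\le\lambda\,\tau(s^{\mathcal M}(\xi))\quad\text{and}\quad \tau(s^{\mathcal M}(a^*\xi))\le\lambda\,\tau(s^{\mathcal M}(\xi))\qquad\text{for all }\xi\in H.$$ \textbf{Theorem.} Let $\mathcal M=\mathcal B(\ell_2)$, where $\ell_2=\ell_2(\mathbb N)$, act by left multiplication on the Hilbert space $\mathrm{HS}$ of Hilbert--Schmidt operators on $\ell_2$, and let $\tau=\mathrm{Tr}$ be the standard trace on $\mathcal B(\ell_2)$. Then the vector support expansion C*-algebra of $(\mathcal M\subset\mathcal B(\mathrm{HS}),\mathrm{Tr})$ is not a quantum uniform Roe algebra on $\mathcal M\subset\mathcal B(\mathrm{HS})$: there is no quantum coarse structure on $\mathcal M\subset\mathcal B(\mathrm{HS})$ whose quantum uniform Roe algebra equals it. -/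

import Mathlib

open scoped ENNReal NNReal Topology Pointwise InnerProductSpace

/-! ### Quantum relations, quantum coarse structures and quantum uniform Roe algebras -/

section General

variable {H : Type*} [NormedAddCommGroup H] [InnerProductSpace ℂ H] [CompleteSpace H]

/-- The weak* (ultraweak, σ-weak) topology on `B(H)`: the initial topology for the functionals
`a ↦ ∑ n, ⟪ξ n, a (η n)⟫` with `ξ`, `η` square-summable sequences in `H`. These functionals are
exactly the elements of the predual of `B(H)`. -/
@[reducible]
noncomputable def weakStarTopology (H : Type*) [NormedAddCommGroup H] [InnerProductSpace ℂ H] :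
    TopologicalSpace (H →L[ℂ] H) :=
  TopologicalSpace.induced
    (fun (a : H →L[ℂ] H) (x : lp (fun _ : ℕ => H) 2 × lp (fun _ : ℕ => H) 2) =>
      ∑' n, ⟪x.1 n, a (x.2 n)⟫_ℂ)
    inferInstance

/-- A quantum relation on a von Neumann algebra `M ⊆ B(H)`: a weak*-closed linear subspace of
`B(H)` that is a bimodule over the commutant `M'`. -/
structure IsQuantumRelation (M : VonNeumannAlgebra H) (V : Set (H →L[ℂ] H)) : Prop where
  zero_mem : 0 ∈ V
  add_mem : ∀ a ∈ V, ∀ b ∈ V, a + b ∈ V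
  smul_mem : ∀ (z : ℂ), ∀ a ∈ V, z • a ∈ V
  commutant_mul_mem : ∀ x ∈ M.commutant, ∀ a ∈ V, x * a ∈ V
  mul_commutant_mem : ∀ x ∈ M.commutant, ∀ a ∈ V, a * x ∈ V
  isClosed : IsClosed[weakStarTopology H] V

/-- A quantum coarse structure on a von Neumann algebra `M ⊆ B(H)`. -/
structure IsQuantumCoarseStructure (M : VonNeumannAlgebra H)
    (𝒱 : Set (Set (H →L[ℂ] H))) : Prop where
  isQuantumRelation : ∀ V ∈ 𝒱, IsQuantumRelation M V
  commutant_mem : (M.commutant : Set (H →L[ℂ] H)) ∈ 𝒱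
  subset_mem : ∀ V₁ ∈ 𝒱, ∀ V₂, IsQuantumRelation M V₂ → V₂ ⊆ V₁ → V₂ ∈ 𝒱
  star_mem : ∀ V ∈ 𝒱, star V ∈ 𝒱
  sum_mem : ∀ V₁ ∈ 𝒱, ∀ V₂ ∈ 𝒱, closure[weakStarTopology H] (V₁ + V₂) ∈ 𝒱
  product_mem : ∀ V₁ ∈ 𝒱, ∀ V₂ ∈ 𝒱,
    closure[weakStarTopology H]
      (Submodule.span ℂ (V₁ * V₂) : Set (H →L[ℂ] H)) ∈ 𝒱

/-- The algebraic quantum uniform Roe algebra: the union of all members of `𝒱`. -/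
def algebraicQuantumUniformRoeAlgebra (𝒱 : Set (Set (H →L[ℂ] H))) : Set (H →L[ℂ] H) :=
  ⋃₀ 𝒱

/-- The quantum uniform Roe algebra: the operator-norm closure of the union of all members
of `𝒱`. -/
def quantumUniformRoeAlgebra (𝒱 : Set (Set (H →L[ℂ] H))) : Set (H →L[ℂ] H) :=
  closure (algebraicQuantumUniformRoeAlgebra 𝒱)

/-! ### Supports and vector support expansion -/

/-- `p` is the smallest projection in `M` that fixes `ξ`. -/
def IsVectorSupport (M : VonNeumannAlgebra H) (ξ : H) (p : H →L[ℂ] H) : Prop :=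
  IsLeast {q : H →L[ℂ] H | q ∈ M ∧ IsStarProjection q ∧ q ξ = ξ} p

theorem exists_isVectorSupport (M : VonNeumannAlgebra H) (ξ : H) :
    ∃ p, IsVectorSupport M ξ p := by
  -- the orthogonal projection onto the closure of `M' ξ`
  let S : Submodule ℂ H :=
    { carrier := {v | ∃ x ∈ M.commutant, x ξ = v}
      add_mem' := by
        rintro _ _ ⟨x, hx, rfl⟩ ⟨y, hy, rfl⟩
        exact ⟨x + y, add_mem hx hy, rfl⟩
      zero_mem' := ⟨0, zero_mem _, rfl⟩
      smul_mem' := by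
        rintro z _ ⟨x, hx, rfl⟩
        exact ⟨z • x, M.commutant.toStarSubalgebra.smul_mem hx z, rfl⟩ }
  let K : Submodule ℂ H := S.topologicalClosure
  have : CompleteSpace K := (Submodule.isClosed_topologicalClosure S).completeSpace_coe
  have hξ : ξ ∈ K := S.le_topologicalClosure ⟨1, one_mem _, rfl⟩
  refine ⟨K.starProjection, ⟨?_, isStarProjection_starProjection, ?_⟩, ?_⟩
  · rw [VonNeumannAlgebra.IsStarProjection.mem_iff isStarProjection_starProjection]
    intro y hy
    rw [Submodule.range_starProjection, Module.End.mem_invtSubmodule]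
    intro v hv
    have hm : Set.MapsTo y (S : Set H) (S : Set H) := by
      rintro _ ⟨x, hx, rfl⟩
      exact ⟨y * x, mul_mem hy hx, rfl⟩
    exact hm.closure y.continuous hv
  · exact Submodule.starProjection_eq_self_iff.2 hξ
  · rintro q ⟨hqM, hq, hqξ⟩
    obtain ⟨_, hq'⟩ := isStarProjection_iff_eq_starProjection_range.1 hq
    rw [hq', Submodule.starProjection_le_starProjection_iff]
    refine Submodule.topologicalClosure_minimal S ?_
      (ContinuousLinearMap.IsIdempotentElem.isClosed_range hq.isIdempotentElem)
    rintro _ ⟨x, hx, rfl⟩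
    refine ⟨x ξ, ?_⟩
    have h := VonNeumannAlgebra.mem_commutant_iff.1 hx q hqM
    have h2 := congrArg (fun f : H →L[ℂ] H => f ξ) h
    simpa [hqξ] using h2

/-- The `M`-support `s^M(ξ)` of a vector: the smallest projection in `M` fixing `ξ`. -/
noncomputable def vectorSupport (M : VonNeumannAlgebra H) (ξ : H) : M :=
  ⟨(exists_isVectorSupport M ξ).choose, (exists_isVectorSupport M ξ).choose_spec.1.1⟩

theorem isVectorSupport_vectorSupport (M : VonNeumannAlgebra H) (ξ : H) :
    IsVectorSupport M ξ (vectorSupport M ξ) :=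
  (exists_isVectorSupport M ξ).choose_spec

/-- `a ∈ B(H)` is `l`-vector constrained with respect to `M ⊆ B(H)` and a trace `τ` on `M`
(only the values of `τ` on positive elements matter). -/
def IsVectorConstrainedBy (M : VonNeumannAlgebra H) (τ : M → ℝ≥0∞) (l : ℝ≥0)
    (a : H →L[ℂ] H) : Prop :=
  ∀ ξ : H, τ (vectorSupport M (a ξ)) ≤ l * τ (vectorSupport M ξ) ∧
    τ (vectorSupport M (star a ξ)) ≤ l * τ (vectorSupport M ξ)

/-- `a` is vector constrained if it is `l`-vector constrained for some `l ≥ 0`. -/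
def IsVectorConstrained (M : VonNeumannAlgebra H) (τ : M → ℝ≥0∞) (a : H →L[ℂ] H) : Prop :=
  ∃ l : ℝ≥0, IsVectorConstrainedBy M τ l a

/-- The vector support expansion C*-algebra of `M ⊆ B(H)` and `τ`: the operator-norm closure of
the set of vector constrained operators. -/
def vectorSupportExpansionAlgebra (M : VonNeumannAlgebra H) (τ : M → ℝ≥0∞) :
    Set (H →L[ℂ] H) :=
  closure {a | IsVectorConstrained M τ a}

end General

/-! ### Hilbert–Schmidt operators on `ℓ²(ℕ)` -/

/-- The Hilbert space `ℓ²(ℕ)`. -/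
abbrev EllTwo : Type := lp (fun _ : ℕ => ℂ) 2

/-- The canonical orthonormal basis of `ℓ²(ℕ)`. -/
noncomputable def stdBasis (n : ℕ) : EllTwo := lp.single 2 n (1 : ℂ)

theorem summable_sq_iff_memℓp {E : Type*} [NormedAddCommGroup E] (f : ℕ → E) :
    Summable (fun n => ‖f n‖ ^ 2) ↔ Memℓp f 2 := by
  rw [memℓp_gen_iff (by norm_num)]
  simp

/-- The space of Hilbert–Schmidt operators, as a linear subspace of `B(ℓ²)`. -/
def hilbertSchmidtSubmodule : Submodule ℂ (EllTwo →L[ℂ] EllTwo) where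
  carrier := {c | Summable fun n => ‖c (stdBasis n)‖ ^ 2}
  add_mem' := by
    intro c d hc hd
    have h := ((summable_sq_iff_memℓp _).1 hc).add ((summable_sq_iff_memℓp _).1 hd)
    exact (summable_sq_iff_memℓp _).2 h
  zero_mem' := by simp [summable_zero]
  smul_mem' := by
    intro z c hc
    have h := ((summable_sq_iff_memℓp _).1 hc).const_smul z
    exact (summable_sq_iff_memℓp _).2 h

/-- The Hilbert space `HS` of Hilbert–Schmidt operators on `ℓ²`. It is a type of its own since its
norm is the Hilbert–Schmidt norm and not the operator norm. -/
def HS : Type := hilbertSchmidtSubmodule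

namespace HS

noncomputable instance : AddCommGroup HS := inferInstanceAs (AddCommGroup hilbertSchmidtSubmodule)

noncomputable instance : Module ℂ HS := inferInstanceAs (Module ℂ hilbertSchmidtSubmodule)

/-- The operator on `ℓ²` underlying a vector of `HS`. -/
noncomputable def toOp : HS →ₗ[ℂ] (EllTwo →L[ℂ] EllTwo) := hilbertSchmidtSubmodule.subtype

theorem toOp_injective : Function.Injective toOp := Subtype.val_injective

theorem summable_toOp (c : HS) : Summable fun n => ‖toOp c (stdBasis n)‖ ^ 2 := c.2

/-- The vector of `HS` given by an operator with square-summable columns. -/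
def ofOp (c : EllTwo →L[ℂ] EllTwo) (hc : Summable fun n => ‖c (stdBasis n)‖ ^ 2) : HS :=
  ⟨c, hc⟩

@[simp]
theorem toOp_ofOp (c : EllTwo →L[ℂ] EllTwo) (hc) : toOp (ofOp c hc) = c := rfl

/-- The sequence of columns `(c eₙ)ₙ` of a Hilbert–Schmidt operator. -/
noncomputable def columns : HS →ₗ[ℂ] lp (fun _ : ℕ => EllTwo) 2 where
  toFun c := ⟨fun n => toOp c (stdBasis n), (summable_sq_iff_memℓp _).1 (summable_toOp c)⟩
  map_add' _ _ := rfl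
  map_smul' _ _ := rfl

@[simp]
theorem columns_apply (c : HS) (n : ℕ) : columns c n = toOp c (stdBasis n) := rfl

theorem clm_ext {E : Type*} [NormedAddCommGroup E] [NormedSpace ℂ E]
    {c d : EllTwo →L[ℂ] E} (h : ∀ n, c (stdBasis n) = d (stdBasis n)) : c = d := by
  ext x
  have hx : HasSum (fun n => x n • stdBasis n) x := by
    have h0 := lp.hasSum_single (E := fun _ : ℕ => ℂ) (p := 2) ENNReal.ofNat_ne_top x
    have h1 : (fun n => x n • stdBasis n) = fun n => lp.single 2 n (x n) := by
      funext n
      rw [stdBasis, ← lp.single_smul, smul_eq_mul, mul_one]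
    rwa [h1]
  have h1 := c.hasSum hx
  have h2 := d.hasSum hx
  simp only [map_smul, h] at h1 h2
  exact h1.unique h2

theorem columns_injective : Function.Injective columns := by
  intro c d h
  apply toOp_injective
  apply clm_ext
  intro n
  have := congrArg (fun f : lp (fun _ : ℕ => EllTwo) 2 => f n) h
  exact this

noncomputable instance : NormedAddCommGroup HS :=
  NormedAddCommGroup.induced HS _ columns columns_injective

theorem norm_eq_columns (c : HS) : ‖c‖ = ‖columns c‖ := rfl

/-- The Hilbert–Schmidt inner product `∑ n, ⟪c eₙ, d eₙ⟫ = Tr (c* d)`, linear in the second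
variable. -/
noncomputable instance : InnerProductSpace ℂ HS where
  norm_smul_le z c := by
    simp only [norm_eq_columns, map_smul]
    exact norm_smul_le z (columns c)
  inner c d := ∑' n, ⟪toOp c (stdBasis n), toOp d (stdBasis n)⟫_ℂ
  norm_sq_eq_re_inner c := by
    rw [norm_eq_columns, norm_sq_eq_re_inner (𝕜 := ℂ), lp.inner_eq_tsum]
    rfl
  conj_inner_symm c d := by
    have := inner_conj_symm (𝕜 := ℂ) (columns c) (columns d)
    rwa [lp.inner_eq_tsum, lp.inner_eq_tsum] at this
  add_left c d e := by
    have := inner_add_left (𝕜 := ℂ) (columns c) (columns d) (columns e)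
    rwa [← map_add, lp.inner_eq_tsum, lp.inner_eq_tsum, lp.inner_eq_tsum] at this
  smul_left c d z := by
    have := inner_smul_left (𝕜 := ℂ) (columns c) (columns d) z
    rwa [← map_smul, lp.inner_eq_tsum, lp.inner_eq_tsum] at this

theorem inner_eq_tsum (c d : HS) :
    ⟪c, d⟫_ℂ = ∑' n, ⟪toOp c (stdBasis n), toOp d (stdBasis n)⟫_ℂ := rfl

theorem norm_sq_eq_tsum (c : HS) : ‖c‖ ^ 2 = ∑' n, ‖toOp c (stdBasis n)‖ ^ 2 := by
  have h := lp.norm_rpow_eq_tsum (p := 2) (by norm_num) (columns c)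
  simpa [norm_eq_columns] using h

theorem norm_toOp_stdBasis_le (c : HS) (n : ℕ) : ‖toOp c (stdBasis n)‖ ≤ ‖c‖ :=
  lp.norm_apply_le_norm (by norm_num) (columns c) n

theorem columns_surjective : Function.Surjective columns := by
  intro f
  -- the adjoint `y ↦ (⟪f n, y⟫)ₙ` of the operator with columns `f n`
  have hle : ∀ (y : EllTwo) (n : ℕ), ‖⟪f n, y⟫_ℂ‖ ^ 2 ≤ ‖y‖ ^ 2 * ‖f n‖ ^ 2 := by
    intro y n
    rw [← mul_pow, mul_comm]
    gcongr
    exact norm_inner_le_norm _ _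
  have hf : Summable fun n => ‖f n‖ ^ 2 := (summable_sq_iff_memℓp _).2 f.2
  have hsum : ∀ y : EllTwo, Summable fun n => ‖⟪f n, y⟫_ℂ‖ ^ 2 := fun y =>
    Summable.of_nonneg_of_le (fun n => by positivity) (hle y) (hf.mul_left _)
  have hf2 : ‖f‖ ^ 2 = ∑' n, ‖f n‖ ^ 2 := by
    simpa using lp.norm_rpow_eq_tsum (p := 2) (by norm_num) f
  let g : EllTwo →ₗ[ℂ] EllTwo :=
    { toFun := fun y => ⟨fun n => ⟪f n, y⟫_ℂ, (summable_sq_iff_memℓp _).1 (hsum y)⟩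
      map_add' := fun x y => by ext n; exact inner_add_right _ _ _
      map_smul' := fun z y => by ext n; exact inner_smul_right _ _ _ }
  have hg : ∀ y, ‖g y‖ ≤ ‖f‖ * ‖y‖ := by
    intro y
    refine le_of_sq_le_sq ?_ (by positivity)
    have h1 : ‖g y‖ ^ 2 = ∑' n, ‖⟪f n, y⟫_ℂ‖ ^ 2 := by
      have h0 : ‖g y‖ ^ 2 = ∑' n, ‖g y n‖ ^ 2 := by
        simpa using lp.norm_rpow_eq_tsum (p := 2) (by norm_num) (g y)
      exact h0
    rw [h1, mul_pow, hf2, mul_comm, ← tsum_mul_left]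
    exact (hsum y).tsum_le_tsum (hle y) (hf.mul_left _)
  let G : EllTwo →L[ℂ] EllTwo := g.mkContinuous ‖f‖ hg
  have hcol : ∀ n, (ContinuousLinearMap.adjoint G) (stdBasis n) = f n := by
    intro n
    refine ext_inner_right ℂ fun y => ?_
    rw [ContinuousLinearMap.adjoint_inner_left, stdBasis, lp.inner_single_left]
    simp [G, g]
  refine ⟨ofOp (ContinuousLinearMap.adjoint G) ?_, ?_⟩
  · simpa only [hcol] using hf
  · ext1
    funext n
    exact hcol n

/-- A Hilbert–Schmidt operator is determined by its columns, isometrically. -/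
noncomputable def columnsEquiv : HS ≃ₗᵢ[ℂ] lp (fun _ : ℕ => EllTwo) 2 where
  toLinearEquiv := LinearEquiv.ofBijective columns ⟨columns_injective, columns_surjective⟩
  norm_map' _ := rfl

instance : CompleteSpace HS :=
  columnsEquiv.toIsometryEquiv.completeSpace

/-! ### `B(ℓ²)` acting on `HS` by left multiplication -/

theorem norm_comp_sq_le (b c : EllTwo →L[ℂ] EllTwo) (n : ℕ) :
    ‖(b * c) (stdBasis n)‖ ^ 2 ≤ ‖b‖ ^ 2 * ‖c (stdBasis n)‖ ^ 2 := by
  rw [← mul_pow]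
  gcongr
  exact b.le_opNorm _

/-- Left multiplication `L(b) : c ↦ b c` on `HS`. -/
noncomputable def leftMul (b : EllTwo →L[ℂ] EllTwo) : HS →L[ℂ] HS :=
  LinearMap.mkContinuous
    { toFun := fun c => ofOp (b * toOp c)
        (Summable.of_nonneg_of_le (fun _ => by positivity) (norm_comp_sq_le b (toOp c))
          ((summable_toOp c).mul_left _))
      map_add' := fun c d => toOp_injective (by simp [mul_add])
      map_smul' := fun z c => toOp_injective (by simp) }
    ‖b‖ (by
      intro c
      refine le_of_sq_le_sq ?_ (by positivity)
      rw [mul_pow, norm_sq_eq_tsum, norm_sq_eq_tsum, ← tsum_mul_left]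
      exact Summable.tsum_le_tsum (norm_comp_sq_le b (toOp c)) (summable_toOp _)
        ((summable_toOp c).mul_left _))

@[simp]
theorem toOp_leftMul (b : EllTwo →L[ℂ] EllTwo) (c : HS) : toOp (leftMul b c) = b * toOp c := rfl

theorem leftMul_star (b : EllTwo →L[ℂ] EllTwo) : leftMul (star b) = star (leftMul b) := by
  rw [ContinuousLinearMap.star_eq_adjoint (leftMul b), ContinuousLinearMap.eq_adjoint_iff]
  intro c d
  simp only [inner_eq_tsum, toOp_leftMul, mul_apply_eq_comp,
    ContinuousLinearMap.star_eq_adjoint, ContinuousLinearMap.adjoint_inner_left]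

/-- The vector of `HS` with zeroth column `x` and all other columns `0`. -/
noncomputable def zerothColumn : EllTwo →L[ℂ] HS :=
  LinearMap.mkContinuous
    (columnsEquiv.symm.toLinearEquiv.toLinearMap ∘ₗ
      lp.lsingle (𝕜 := ℂ) (E := fun _ : ℕ => EllTwo) 2 0) 1 (by
    intro x
    have h : ‖columnsEquiv.symm (lp.single (E := fun _ : ℕ => EllTwo) 2 0 x)‖ = ‖x‖ := by
      rw [LinearIsometryEquiv.norm_map, lp.norm_single (by norm_num)]
    rw [one_mul]
    exact h.le)

theorem columns_zerothColumn (x : EllTwo) :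
    columns (zerothColumn x) = lp.single (E := fun _ : ℕ => EllTwo) 2 0 x :=
  columnsEquiv.apply_symm_apply _

theorem toOp_zerothColumn_zero (x : EllTwo) : toOp (zerothColumn x) (stdBasis 0) = x := by
  rw [← columns_apply, columns_zerothColumn, lp.single_apply_self]

theorem leftMul_zerothColumn (b : EllTwo →L[ℂ] EllTwo) (x : EllTwo) :
    leftMul b (zerothColumn x) = zerothColumn (b x) := by
  apply columns_injective
  ext1
  funext n
  rw [columns_apply, toOp_leftMul, mul_apply_eq_comp, ← columns_apply,
    columns_zerothColumn, columns_zerothColumn]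
  by_cases h : n = 0
  · subst h
    rw [lp.single_apply_self, lp.single_apply_self]
  · rw [lp.single_apply_ne _ _ _ h, lp.single_apply_ne _ _ _ h, map_zero]

theorem leftMul_injective : Function.Injective leftMul := by
  intro b b' h
  ext1 x
  have h1 := congrArg (fun T : HS →L[ℂ] HS => toOp (T (zerothColumn x)) (stdBasis 0)) h
  simpa only [leftMul_zerothColumn, toOp_zerothColumn_zero] using h1

/-- The column map `c ↦ c eₙ`. -/
noncomputable def column (n : ℕ) : HS →L[ℂ] EllTwo :=
  LinearMap.mkContinuous
    { toFun := fun c => toOp c (stdBasis n)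
      map_add' := fun c d => by simp
      map_smul' := fun z c => by simp } 1 (by
    intro c
    rw [one_mul]
    exact norm_toOp_stdBasis_le c n)

@[simp]
theorem column_apply (n : ℕ) (c : HS) : column n c = toOp c (stdBasis n) := rfl

/-- The algebra of left multiplications is its own double commutant. -/
theorem centralizer_centralizer_range_leftMul :
    Set.centralizer (Set.centralizer (Set.range leftMul)) = Set.range leftMul := by
  refine Set.Subset.antisymm ?_ Set.subset_centralizer_centralizer
  intro T hT
  have hcomm : ∀ n c, T (zerothColumn (toOp c (stdBasis n)))
      = zerothColumn (toOp (T c) (stdBasis n)) := by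
    intro n c
    have hR : zerothColumn ∘L column n ∈ Set.centralizer (Set.range leftMul) := by
      rintro _ ⟨b, rfl⟩
      ext1 d
      simp [leftMul_zerothColumn]
    have h := congrArg (fun S : HS →L[ℂ] HS => S c) (hT _ hR)
    exact h.symm
  refine ⟨column 0 ∘L T ∘L zerothColumn, ?_⟩
  ext1 c
  apply toOp_injective
  apply clm_ext
  intro n
  simp [hcomm, toOp_zerothColumn_zero]

end HS

/-- The von Neumann algebra `B(ℓ²)` in standard form, i.e. the algebra of all left multiplications
`L(b)`, `b ∈ B(ℓ²)`, on `HS`. -/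
noncomputable def leftMulAlgebra : VonNeumannAlgebra HS where
  carrier := Set.range HS.leftMul
  mul_mem' := by
    rintro _ _ ⟨a, rfl⟩ ⟨b, rfl⟩
    exact ⟨a * b, rfl⟩
  add_mem' := by
    rintro _ _ ⟨a, rfl⟩ ⟨b, rfl⟩
    refine ⟨a + b, ?_⟩
    ext1 c
    exact HS.toOp_injective (by simp [add_mul])
  algebraMap_mem' := by
    intro z
    refine ⟨algebraMap ℂ _ z, ?_⟩
    ext1 c
    exact HS.toOp_injective (by simp [Algebra.algebraMap_eq_smul_one])
  star_mem' := by
    rintro _ ⟨a, rfl⟩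
    exact ⟨star a, HS.leftMul_star a⟩
  centralizer_centralizer' := HS.centralizer_centralizer_range_leftMul

/-- The identification `b ↦ L(b)` of `B(ℓ²)` with the algebra of left multiplications. -/
noncomputable def leftMulEquiv : (EllTwo →L[ℂ] EllTwo) ≃ leftMulAlgebra :=
  Equiv.ofInjective HS.leftMul HS.leftMul_injective

/-- The standard trace `Tr b = ∑ n, ⟪eₙ, b eₙ⟫ ∈ [0, ∞]` of a positive operator `b` on `ℓ²`. (The
value at an operator that is not positive is irrelevant.) -/
noncomputable def stdTrace (b : EllTwo →L[ℂ] EllTwo) : ℝ≥0∞ :=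
  ∑' n, ENNReal.ofReal (RCLike.re ⟪stdBasis n, b (stdBasis n)⟫_ℂ)

/-- The standard trace on `B(ℓ²)` acting by left multiplication on `HS`: `L(b) ↦ Tr b`. -/
noncomputable def leftMulTrace (x : leftMulAlgebra) : ℝ≥0∞ :=
  stdTrace (leftMulEquiv.symm x)

/-! ### Traces of projections on `ℓ²` -/

/-! A quantum relation absorbs right multiplications by matrix units on either side, and it is
closed under bounded strong limits. Vector constraint is not stable under the infinite sums this
allows, even up to norm closure.

The witness is `rowToColumn`, written r. Both r and its adjoint take only values of rank at most
one, while a nonzero vector has support of trace at least one. So r is vector constrained, with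
constant 1 (`isVectorConstrained_of_rank_le_one`). The block amplification T combines infinitely
many terms R x R' with R, R' in the commutant, copying the n-th column of its argument into n + 1
slots with weight (n + 1)^(-1/2). It is a linear contraction in x, because the squared weights of
each block add up to 1, and it maps every quantum relation into itself (`blockAmplification_mem`).

On the rank-one unit vector with n-th column e₀, T(r) takes as value a unit vector of rank n + 1
whose singular values are all (n + 1)^(-1/2). A projection of trace at most k retains at most k/(n +
1) of its squared norm. Taking n large thus keeps T(r) at distance at least 1/4 from every vector
constrained operator (`one_fourth_le_norm_sub_of_isVectorConstrained`).

If the algebra were a quantum uniform Roe algebra, r would be close to some v in a quantum relation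
V. Then T(r) would be equally close to T(v) ∈ V, hence close to vector constrained operators, a
contradiction. -/

theorem inner_stdBasis_right (x : EllTwo) (n : ℕ) : ⟪x, stdBasis n⟫_ℂ = star (x n) := by
  rw [stdBasis, lp.inner_single_right]
  simp

theorem stdBasis_apply (m n : ℕ) : stdBasis m n = if n = m then (1 : ℂ) else 0 := by
  rw [stdBasis, lp.single_apply, Pi.single_apply]

theorem norm_stdBasis (n : ℕ) : ‖stdBasis n‖ = 1 := by
  rw [stdBasis, lp.norm_single (by norm_num), norm_one]

theorem hasSum_norm_sq_inner_stdBasis (x : EllTwo) :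
    HasSum (fun n => ‖⟪x, stdBasis n⟫_ℂ‖ ^ 2) (‖x‖ ^ 2) := by
  simpa [inner_stdBasis_right] using lp.hasSum_norm (p := 2) (by norm_num) x

theorem tsum_ofReal_norm_sq_inner_stdBasis (x : EllTwo) :
    ∑' n, ENNReal.ofReal (‖⟪x, stdBasis n⟫_ℂ‖ ^ 2) = ENNReal.ofReal (‖x‖ ^ 2) := by
  have h := hasSum_norm_sq_inner_stdBasis x
  rw [← h.tsum_eq, ENNReal.ofReal_tsum_of_nonneg (fun _ => by positivity) h.summable]

section

variable {E : Type*} [NormedAddCommGroup E] [InnerProductSpace ℂ E] [CompleteSpace E]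

theorem IsStarProjection.inner_apply_apply {q : E →L[ℂ] E} (hq : IsStarProjection q) (x y : E) :
    ⟪q x, q y⟫_ℂ = ⟪x, q y⟫_ℂ := by
  have h1 : ContinuousLinearMap.adjoint q = q := hq.isSelfAdjoint
  have h2 : q (q y) = q y := congrArg (fun f : E →L[ℂ] E => f y) hq.isIdempotentElem
  rw [← ContinuousLinearMap.adjoint_inner_right, h1, h2]

theorem IsStarProjection.re_inner_apply {q : E →L[ℂ] E} (hq : IsStarProjection q) (x : E) :
    RCLike.re ⟪x, q x⟫_ℂ = ‖q x‖ ^ 2 := by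
  rw [← hq.inner_apply_apply, norm_sq_eq_re_inner (𝕜 := ℂ)]

theorem IsStarProjection.norm_apply_le {q : E →L[ℂ] E} (hq : IsStarProjection q) (x : E) :
    ‖q x‖ ≤ ‖x‖ := by
  simpa using q.le_of_opNorm_le hq.norm_le x

end

theorem stdTrace_eq_tsum_norm_sq {q : EllTwo →L[ℂ] EllTwo} (hq : IsStarProjection q) :
    stdTrace q = ∑' n, ENNReal.ofReal (‖q (stdBasis n)‖ ^ 2) := by
  simp only [stdTrace, hq.re_inner_apply]

/-- For a nonzero vector q y in the range, Parseval and Cauchy–Schwarz give ‖q y‖² = ∑ |⟪q y, q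
eₙ⟫|² ≤ ‖q y‖² Tr q, and ‖q y‖² cancels. -/
theorem one_le_stdTrace {q : EllTwo →L[ℂ] EllTwo} (hq : IsStarProjection q) (h : q ≠ 0) :
    1 ≤ stdTrace q := by
  obtain ⟨y, hy⟩ : ∃ y, q y ≠ 0 := by
    by_contra! h'
    exact h (ContinuousLinearMap.ext h')
  have hle : ∀ n, ‖⟪q y, stdBasis n⟫_ℂ‖ ^ 2 ≤ ‖q y‖ ^ 2 * ‖q (stdBasis n)‖ ^ 2 := by
    intro n
    have h1 : ⟪q y, stdBasis n⟫_ℂ = ⟪q y, q (stdBasis n)⟫_ℂ := by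
      rw [← inner_conj_symm, ← hq.inner_apply_apply, inner_conj_symm]
    rw [h1, ← mul_pow]
    gcongr
    exact norm_inner_le_norm _ _
  have hpos : 0 < ‖q y‖ ^ 2 := by positivity
  have h2 : ENNReal.ofReal (‖q y‖ ^ 2) ≤ ENNReal.ofReal (‖q y‖ ^ 2) * stdTrace q := by
    rw [stdTrace_eq_tsum_norm_sq hq, ← ENNReal.tsum_mul_left]
    refine (tsum_ofReal_norm_sq_inner_stdBasis (q y)).symm.le.trans
      (ENNReal.tsum_le_tsum fun n => ?_)
    rw [← ENNReal.ofReal_mul hpos.le]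
    exact ENNReal.ofReal_le_ofReal (hle n)
  have h3 : ENNReal.ofReal (‖q y‖ ^ 2) * 1 ≤ ENNReal.ofReal (‖q y‖ ^ 2) * stdTrace q := by
    rwa [mul_one]
  exact (ENNReal.mul_le_mul_iff_right (by simpa using hy) ENNReal.ofReal_ne_top).1 h3

theorem stdTrace_starProjection_span_singleton_le (x : EllTwo) :
    stdTrace (ℂ ∙ x).starProjection ≤ 1 := by
  rw [stdTrace_eq_tsum_norm_sq isStarProjection_starProjection]
  by_cases hx : x = 0
  · simp [hx]
  have hx' : ‖x‖ ≠ 0 := norm_ne_zero_iff.2 hx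
  have h : ∀ n, ‖(ℂ ∙ x).starProjection (stdBasis n)‖ ^ 2
      = (‖x‖ ^ 2)⁻¹ * ‖⟪x, stdBasis n⟫_ℂ‖ ^ 2 := by
    intro n
    rw [Submodule.starProjection_singleton, norm_smul, norm_div]
    simp only [RCLike.norm_ofReal, abs_norm, abs_pow]
    field_simp
  simp only [h]
  simp_rw [ENNReal.ofReal_mul (inv_nonneg.2 (sq_nonneg ‖x‖))]
  rw [ENNReal.tsum_mul_left, tsum_ofReal_norm_sq_inner_stdBasis,
    ← ENNReal.ofReal_mul (by positivity), inv_mul_cancel₀ (by positivity), ENNReal.ofReal_one]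

/-! ### Supports of Hilbert–Schmidt operators and their traces -/

namespace HS

/-- The projection on `ℓ²` whose left multiplication is the support of `c`, that is, the range
projection of `c`. -/
noncomputable def support (c : HS) : EllTwo →L[ℂ] EllTwo :=
  leftMulEquiv.symm (vectorSupport leftMulAlgebra c)

theorem leftMulTrace_vectorSupport (c : HS) :
    leftMulTrace (vectorSupport leftMulAlgebra c) = stdTrace (support c) := rfl

theorem leftMul_support (c : HS) : leftMul (support c) = vectorSupport leftMulAlgebra c :=
  congrArg Subtype.val (leftMulEquiv.apply_symm_apply (vectorSupport leftMulAlgebra c))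

theorem isStarProjection_leftMul_iff {q : EllTwo →L[ℂ] EllTwo} :
    IsStarProjection (leftMul q) ↔ IsStarProjection q := by
  constructor
  · intro h
    exact ⟨leftMul_injective h.isIdempotentElem,
      leftMul_injective ((leftMul_star q).trans h.isSelfAdjoint)⟩
  · intro h
    exact ⟨congrArg leftMul h.isIdempotentElem,
      (leftMul_star q).symm.trans (congrArg leftMul h.isSelfAdjoint)⟩

theorem isStarProjection_support (c : HS) : IsStarProjection (support c) := by
  rw [← isStarProjection_leftMul_iff, leftMul_support]
  exact (isVectorSupport_vectorSupport leftMulAlgebra c).1.2.1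

theorem leftMul_support_apply (c : HS) : leftMul (support c) c = c := by
  rw [leftMul_support]
  exact (isVectorSupport_vectorSupport leftMulAlgebra c).1.2.2

theorem inner_zerothColumn (c : HS) (x : EllTwo) :
    ⟪zerothColumn x, c⟫_ℂ = ⟪x, toOp c (stdBasis 0)⟫_ℂ := by
  rw [inner_eq_tsum, tsum_eq_single 0, toOp_zerothColumn_zero]
  intro n hn
  rw [← columns_apply, columns_zerothColumn, lp.single_apply_ne _ _ _ hn, inner_zero_left]

/-- Minimality of the support gives an inequality between left multiplications on `HS`. Testing it
on the vectors with zeroth column eₙ compares the diagonal entries on `ℓ²`. -/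
theorem stdTrace_support_le {c : HS} {e : EllTwo →L[ℂ] EllTwo} (he : IsStarProjection e)
    (hec : leftMul e c = c) : stdTrace (support c) ≤ stdTrace e := by
  have hle : leftMul (support c) ≤ leftMul e := by
    rw [leftMul_support]
    exact (isVectorSupport_vectorSupport leftMulAlgebra c).2
      ⟨⟨e, rfl⟩, isStarProjection_leftMul_iff.2 he, hec⟩
  refine ENNReal.tsum_le_tsum fun n => ENNReal.ofReal_le_ofReal ?_
  have h := (ContinuousLinearMap.le_def _ _).1 hle |>.re_inner_nonneg_right
    (zerothColumn (stdBasis n))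
  rw [sub_apply, inner_sub_right, leftMul_zerothColumn, leftMul_zerothColumn,
    inner_zerothColumn, inner_zerothColumn, toOp_zerothColumn_zero, toOp_zerothColumn_zero,
    map_sub] at h
  linarith

theorem stdTrace_support_le_one {c : HS} {x : EllTwo}
    (h : ∀ n, toOp c (stdBasis n) ∈ Submodule.span ℂ {x}) : stdTrace (support c) ≤ 1 := by
  refine (stdTrace_support_le (e := (ℂ ∙ x).starProjection)
    isStarProjection_starProjection ?_).trans (stdTrace_starProjection_span_singleton_le x)
  apply toOp_injective
  apply clm_ext
  intro n
  exact Submodule.starProjection_eq_self_iff.2 (h n)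

theorem one_le_stdTrace_support {c : HS} (hc : c ≠ 0) : 1 ≤ stdTrace (support c) := by
  refine one_le_stdTrace (isStarProjection_support c) fun h => hc ?_
  rw [← leftMul_support_apply c, h]
  exact toOp_injective (by simp)

theorem isVectorConstrained_of_rank_le_one {a : HS →L[ℂ] HS}
    (h : ∀ c, ∃ x, ∀ n, toOp (a c) (stdBasis n) ∈ Submodule.span ℂ {x})
    (h' : ∀ c, ∃ x, ∀ n, toOp (star a c) (stdBasis n) ∈ Submodule.span ℂ {x}) :
    IsVectorConstrained leftMulAlgebra leftMulTrace a := by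
  refine ⟨1, fun c => ?_⟩
  simp only [leftMulTrace_vectorSupport, ENNReal.coe_one, one_mul]
  -- The zero vector has support of trace below one, so it needs separate treatment; there both
  -- sides agree.
  by_cases hc : c = 0
  · subst hc
    simp
  obtain ⟨x, hx⟩ := h c
  obtain ⟨y, hy⟩ := h' c
  exact ⟨(stdTrace_support_le_one hx).trans (one_le_stdTrace_support hc),
    (stdTrace_support_le_one hy).trans (one_le_stdTrace_support hc)⟩

end HS

/-! ### Strong limits in weak*-closed sets -/

/-- A strongly convergent sequence is bounded by Banach–Steinhaus, and for bounded sequences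
dominated convergence upgrades strong convergence to weak* convergence. -/
theorem mem_of_tendsto_strong {H : Type*} [NormedAddCommGroup H] [InnerProductSpace ℂ H]
    [CompleteSpace H] {V : Set (H →L[ℂ] H)} (hV : IsClosed[weakStarTopology H] V)
    {T : ℕ → H →L[ℂ] H} {S : H →L[ℂ] H} (hT : ∀ k, T k ∈ V)
    (h : ∀ ξ, Filter.Tendsto (fun k => T k ξ) Filter.atTop (𝓝 (S ξ))) : S ∈ V := by
  obtain ⟨C, hC⟩ : ∃ C, ∀ k, ‖T k‖ ≤ C := by
    refine banach_steinhaus fun ξ => ?_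
    obtain ⟨C, hC⟩ := (h ξ).norm.bddAbove_range
    exact ⟨C, fun k => hC ⟨k, rfl⟩⟩
  have hlim : Filter.Tendsto T Filter.atTop (@nhds _ (weakStarTopology H) S) := by
    rw [nhds_induced, Filter.tendsto_comap_iff, tendsto_pi_nhds]
    rintro ⟨ξ, η⟩
    have hξ : Summable fun n => ‖ξ n‖ ^ 2 := (summable_sq_iff_memℓp _).2 ξ.2
    have hη : Summable fun n => ‖η n‖ ^ 2 := (summable_sq_iff_memℓp _).2 η.2
    refine tendsto_tsum_of_dominated_convergence
      (bound := fun n => |C| * (‖ξ n‖ ^ 2 + ‖η n‖ ^ 2)) ((hξ.add hη).mul_left _) ?_ ?_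
    · intro n
      exact tendsto_const_nhds.inner (h (η n))
    · refine Filter.Eventually.of_forall fun k n => ?_
      calc ‖⟪ξ n, T k (η n)⟫_ℂ‖ ≤ ‖ξ n‖ * ‖T k (η n)‖ := norm_inner_le_norm _ _
        _ ≤ ‖ξ n‖ * (|C| * ‖η n‖) := by
          gcongr
          exact (T k).le_of_opNorm_le ((hC k).trans (le_abs_self C)) _
        _ = |C| * (‖ξ n‖ * ‖η n‖) := by ring
        _ ≤ |C| * (‖ξ n‖ ^ 2 + ‖η n‖ ^ 2) := by
          gcongr
          nlinarith [sq_nonneg (‖ξ n‖ - ‖η n‖), sq_nonneg ‖ξ n‖, sq_nonneg ‖η n‖]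
  let := weakStarTopology H
  exact hV.mem_of_tendsto hlim (Filter.Eventually.of_forall hT)

/-! ### Weights -/

/-- The numbers `β (n, j) = (n + 1)^(-1/2)` for `j ≤ n` and `β (n, j) = 0` for `j > n`, enumerated
by the pairing function. -/
noncomputable def blockWeight (l : ℕ) : ℝ :=
  if l.unpair.2 ≤ l.unpair.1 then (√((l.unpair.1 : ℝ) + 1))⁻¹ else 0

theorem blockWeight_sq_le (l : ℕ) : blockWeight l ^ 2 ≤ ((l.unpair.1 : ℝ) + 1)⁻¹ := by
  unfold blockWeight
  split_ifs
  · rw [inv_pow, Real.sq_sqrt (by positivity)]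
  · rw [zero_pow two_ne_zero]
    positivity

theorem hasSum_blockWeight_sq_pair (n : ℕ) :
    HasSum (fun j => blockWeight (Nat.pair n j) ^ 2) 1 := by
  have h : ∀ j, blockWeight (Nat.pair n j) ^ 2
      = if j ∈ Finset.range (n + 1) then ((n : ℝ) + 1)⁻¹ else 0 := by
    intro j
    simp only [blockWeight, Nat.unpair_pair, Finset.mem_range, Nat.lt_succ_iff]
    split_ifs
    · rw [inv_pow, Real.sq_sqrt (by positivity)]
    · rw [zero_pow two_ne_zero]
  have h1 : (1 : ℝ) = ∑ j ∈ Finset.range (n + 1), blockWeight (Nat.pair n j) ^ 2 := by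
    rw [Finset.sum_congr rfl fun j hj => (h j).trans (if_pos hj), Finset.sum_const,
      Finset.card_range, nsmul_eq_mul, Nat.cast_add, Nat.cast_one, mul_inv_cancel₀ (by positivity)]
  rw [h1]
  exact hasSum_sum_of_ne_finset_zero fun j hj => (h j).trans (if_neg hj)

/-- Each block has total squared weight 1, so spreading g n over the n-th block preserves the sum.
This is what makes the block amplification a contraction. -/
theorem hasSum_blockWeight_sq_mul {g : ℕ → ℝ} (hg : ∀ n, 0 ≤ g n) {s : ℝ} (hs : HasSum g s) :
    HasSum (fun l => blockWeight l ^ 2 * g l.unpair.1) s := by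
  have hrow : ∀ n, HasSum (fun j => blockWeight (Nat.pair n j) ^ 2 * g n) (g n) := fun n => by
    simpa using (hasSum_blockWeight_sq_pair n).mul_right (g n)
  have hsum : Summable fun p : ℕ × ℕ => blockWeight (Nat.pair p.1 p.2) ^ 2 * g p.1 := by
    rw [summable_prod_of_nonneg fun p => mul_nonneg (sq_nonneg _) (hg _)]
    refine ⟨fun n => (hrow n).summable, ?_⟩
    simpa only [(hrow _).tsum_eq] using hs.summable
  have h := hsum.hasSum
  rw [(h.prod_fiberwise hrow).unique hs] at h
  rw [← Nat.pairEquiv.hasSum_iff]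
  convert h using 2 with p
  obtain ⟨n, j⟩ := p
  simp

namespace HS

/-! ### Columns -/

/-- The vector of `HS` with `m`-th column `x` and all other columns `0`. -/
noncomputable def putColumn (m : ℕ) : EllTwo →L[ℂ] HS :=
  (columnsEquiv.symm : _ →L[ℂ] HS) ∘L
    lp.singleContinuousLinearMap ℂ (fun _ : ℕ => EllTwo) 2 m

theorem columns_putColumn (m : ℕ) (x : EllTwo) :
    columns (putColumn m x) = lp.single (E := fun _ : ℕ => EllTwo) 2 m x :=
  columnsEquiv.apply_symm_apply _

theorem column_putColumn (m n : ℕ) (x : EllTwo) :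
    column n (putColumn m x) = if n = m then x else 0 := by
  rw [column_apply, ← columns_apply, columns_putColumn, lp.single_apply, Pi.single_apply]

theorem norm_putColumn (m : ℕ) (x : EllTwo) : ‖putColumn m x‖ = ‖x‖ := by
  rw [norm_eq_columns, columns_putColumn, lp.norm_single (by norm_num)]

theorem ext_column {c d : HS} (h : ∀ n, column n c = column n d) : c = d :=
  toOp_injective (clm_ext h)

theorem column_leftMul (b : EllTwo →L[ℂ] EllTwo) (n : ℕ) (c : HS) :
    column n (leftMul b c) = b (column n c) := rfl

theorem leftMul_putColumn (b : EllTwo →L[ℂ] EllTwo) (m : ℕ) (x : EllTwo) :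
    leftMul b (putColumn m x) = putColumn m (b x) := by
  refine ext_column fun n => ?_
  rw [column_leftMul, column_putColumn, column_putColumn]
  split_ifs
  · rfl
  · exact map_zero b

/-- This operator is right multiplication by a matrix unit, which moves column n to column m. -/
theorem putColumn_comp_column_mem_commutant (m n : ℕ) :
    putColumn m ∘L column n ∈ leftMulAlgebra.commutant := by
  rw [VonNeumannAlgebra.mem_commutant_iff]
  rintro _ ⟨b, rfl⟩
  ext1 c
  exact leftMul_putColumn b m (column n c)

theorem hasSum_putColumn_column (c : HS) : HasSum (fun n => putColumn n (column n c)) c := by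
  have h := lp.hasSum_single (E := fun _ : ℕ => EllTwo) (p := 2) ENNReal.ofNat_ne_top (columns c)
  have h2 := (columnsEquiv.symm : _ →L[ℂ] HS).hasSum h
  have h3 : columnsEquiv.symm (columns c) = c := columnsEquiv.symm_apply_apply c
  have h4 : HasSum (fun n => putColumn n (column n c)) (columnsEquiv.symm (columns c)) := h2
  rwa [h3] at h4

theorem hasSum_norm_sq_column (c : HS) : HasSum (fun n => ‖column n c‖ ^ 2) (‖c‖ ^ 2) := by
  rw [norm_sq_eq_tsum]
  exact (summable_toOp c).hasSum

theorem exists_column_eq {f : ℕ → EllTwo} (hf : Summable fun n => ‖f n‖ ^ 2) :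
    ∃ c : HS, ∀ n, column n c = f n := by
  obtain ⟨c, hc⟩ := columns_surjective ⟨f, (summable_sq_iff_memℓp f).1 hf⟩
  exact ⟨c, fun n => congrArg (fun g : lp (fun _ : ℕ => EllTwo) 2 => g n) hc⟩

/-! ### The block amplification of an operator -/

/-- Column l of the image has squared norm at most ‖x‖² times the squared weight times ‖column
l.unpair.1 c‖². Summing over l by `hasSum_blockWeight_sq_mul` yields ‖x‖² ‖c‖². -/
theorem exists_blockAmplification (x : HS →L[ℂ] HS) : ∃ T : HS →L[ℂ] HS, ‖T‖ ≤ ‖x‖ ∧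
    ∀ l c, column l (T c)
      = (blockWeight l : ℂ) • column 0 (x (putColumn l (column l.unpair.1 c))) := by
  have hle : ∀ (c : HS) (l : ℕ),
      ‖(blockWeight l : ℂ) • column 0 (x (putColumn l (column l.unpair.1 c)))‖ ^ 2
        ≤ ‖x‖ ^ 2 * (blockWeight l ^ 2 * ‖column l.unpair.1 c‖ ^ 2) := by
    intro c l
    have h1 : ‖column 0 (x (putColumn l (column l.unpair.1 c)))‖
        ≤ ‖x‖ * ‖column l.unpair.1 c‖ := by
      rw [← norm_putColumn l (column l.unpair.1 c)]
      exact (norm_toOp_stdBasis_le _ 0).trans (x.le_opNorm _)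
    calc _ = blockWeight l ^ 2 * ‖column 0 (x (putColumn l (column l.unpair.1 c)))‖ ^ 2 := by
          rw [norm_smul, mul_pow, Complex.norm_real, Real.norm_eq_abs, sq_abs]
      _ ≤ blockWeight l ^ 2 * (‖x‖ * ‖column l.unpair.1 c‖) ^ 2 := by gcongr
      _ = _ := by ring
  have hsum : ∀ c : HS, HasSum
      (fun l => ‖x‖ ^ 2 * (blockWeight l ^ 2 * ‖column l.unpair.1 c‖ ^ 2)) (‖x‖ ^ 2 * ‖c‖ ^ 2) :=
    fun c => (hasSum_blockWeight_sq_mul (fun n => sq_nonneg ‖column n c‖)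
      (hasSum_norm_sq_column c)).mul_left _
  have hex := fun c : HS => exists_column_eq
    (Summable.of_nonneg_of_le (fun _ => by positivity) (hle c) (hsum c).summable)
  choose T hT using hex
  let T' : HS →ₗ[ℂ] HS :=
    { toFun := T
      map_add' := fun c d => ext_column fun l => by
        simp only [map_add, hT, smul_add]
      map_smul' := fun z c => ext_column fun l => by
        simp only [map_smul, hT, RingHom.id_apply]
        rw [smul_comm] }
  refine ⟨T'.mkContinuous ‖x‖ fun c => ?_, T'.mkContinuous_norm_le (norm_nonneg x) _,
    fun l c => hT c l⟩
  refine le_of_sq_le_sq ?_ (by positivity)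
  rw [mul_pow]
  refine hasSum_le (fun l => ?_) (hasSum_norm_sq_column (T c)) (hsum c)
  rw [hT]
  exact hle c l

/-- The operator whose value at `c` has, for each pair `(n, j)` with `j ≤ n`, in the column with
number `l = Nat.pair n j` the zeroth column of `(n + 1)^(-1/2) x (d)`, where `d` has the `n`-th
column of `c` as its `l`-th column and no other non-zero column. -/
noncomputable def blockAmplification (x : HS →L[ℂ] HS) : HS →L[ℂ] HS :=
  (exists_blockAmplification x).choose

theorem norm_blockAmplification_le (x : HS →L[ℂ] HS) : ‖blockAmplification x‖ ≤ ‖x‖ :=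
  (exists_blockAmplification x).choose_spec.1

theorem column_blockAmplification (x : HS →L[ℂ] HS) (l : ℕ) (c : HS) :
    column l (blockAmplification x c)
      = (blockWeight l : ℂ) • column 0 (x (putColumn l (column l.unpair.1 c))) :=
  (exists_blockAmplification x).choose_spec.2 l c

theorem blockAmplification_sub (x y : HS →L[ℂ] HS) :
    blockAmplification (x - y) = blockAmplification x - blockAmplification y := by
  ext1 c
  refine ext_column fun l => ?_
  rw [sub_apply, map_sub]
  simp only [column_blockAmplification]
  rw [sub_apply, map_sub, smul_sub]

/-- The amplification is the series of the weighted terms R v R' with R, R' in the commutant. It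
converges strongly, column by column, which suffices for weak*-closed V. -/
theorem blockAmplification_mem {V : Set (HS →L[ℂ] HS)} (hV : IsQuantumRelation leftMulAlgebra V)
    {v : HS →L[ℂ] HS} (hv : v ∈ V) : blockAmplification v ∈ V := by
  let R : ℕ → ℕ → HS →L[ℂ] HS := fun m n => putColumn m ∘L column n
  refine mem_of_tendsto_strong hV.isClosed
    (T := fun k => ∑ l ∈ Finset.range k,
      (blockWeight l : ℂ) • (R l 0 * (v * R l l.unpair.1))) (fun k => ?_) fun c => ?_
  · induction k with
    | zero => simpa using hV.zero_mem
    | succ k ih =>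
      rw [Finset.sum_range_succ]
      exact hV.add_mem _ ih _ (hV.smul_mem _ _
        (hV.commutant_mul_mem _ (putColumn_comp_column_mem_commutant _ _) _
          (hV.mul_commutant_mem _ (putColumn_comp_column_mem_commutant _ _) _ hv)))
  · have h := (hasSum_putColumn_column (blockAmplification v c)).tendsto_sum_nat
    refine h.congr fun k => ?_
    rw [sum_apply]
    refine Finset.sum_congr rfl fun l _ => ?_
    rw [column_blockAmplification, map_smul]
    rfl

/-! ### Moving the zeroth row to the zeroth column -/

theorem exists_zerothRow : ∃ r : HS →L[ℂ] EllTwo, ∀ c n, r c n = column n c 0 := by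
  have hle : ∀ (c : HS) (n : ℕ), ‖column n c 0‖ ^ 2 ≤ ‖column n c‖ ^ 2 := by
    intro c n
    gcongr
    exact lp.norm_apply_le_norm (by norm_num) _ _
  have hsum : ∀ c : HS, Summable fun n => ‖column n c 0‖ ^ 2 := fun c =>
    Summable.of_nonneg_of_le (fun _ => by positivity) (hle c) (hasSum_norm_sq_column c).summable
  let r : HS →ₗ[ℂ] EllTwo :=
    { toFun := fun c => ⟨fun n => column n c 0, (summable_sq_iff_memℓp _).1 (hsum c)⟩
      map_add' := fun c d => by ext n; exact congrArg (fun y : EllTwo => y 0) (map_add (column n) c d)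
      map_smul' := fun z c => by ext n; simp }
  refine ⟨r.mkContinuous 1 fun c => ?_, fun c n => rfl⟩
  rw [one_mul]
  refine le_of_sq_le_sq ?_ (norm_nonneg c)
  have h : HasSum (fun n => ‖column n c 0‖ ^ 2) (‖r c‖ ^ 2) := by
    have h0 : HasSum (fun n => ‖r c n‖ ^ 2) (‖r c‖ ^ 2) := by
      simpa only [ENNReal.toReal_ofNat, Real.rpow_ofNat] using
        lp.hasSum_norm (p := 2) (by norm_num) (r c)
    exact h0
  exact hasSum_le (hle c) h (hasSum_norm_sq_column c)

/-- The operator that moves the zeroth row to the zeroth column and discards all other rows. -/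
noncomputable def rowToColumn : HS →L[ℂ] HS :=
  putColumn 0 ∘L exists_zerothRow.choose

theorem rowToColumn_apply (c : HS) : ∃ x : EllTwo, rowToColumn c = putColumn 0 x ∧
    ∀ n, x n = column n c 0 :=
  ⟨_, rfl, exists_zerothRow.choose_spec c⟩

theorem isVectorConstrained_rowToColumn :
    IsVectorConstrained leftMulAlgebra leftMulTrace rowToColumn := by
  apply isVectorConstrained_of_rank_le_one
  · intro c
    obtain ⟨x, hx, -⟩ := rowToColumn_apply c
    refine ⟨x, fun n => ?_⟩
    rw [hx, ← column_apply, column_putColumn]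
    split_ifs
    · exact Submodule.mem_span_singleton_self x
    · exact zero_mem _
  · intro c
    refine ⟨stdBasis 0, fun n => ?_⟩
    -- Since r depends only on the zeroth row, r L(e) = r. Taking adjoints, the range of r* is fixed
    -- by L(e), so every column lies in the span of e₀.
    set e : EllTwo →L[ℂ] EllTwo := (ℂ ∙ stdBasis 0).starProjection with he
    have he' : IsStarProjection e := isStarProjection_starProjection
    have he0 : ∀ y : EllTwo, e y 0 = y 0 := by
      intro y
      rw [he, Submodule.starProjection_unit_singleton ℂ (norm_stdBasis 0), ← inner_conj_symm,
        inner_stdBasis_right]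
      simp [stdBasis_apply]
    have h1 : rowToColumn * leftMul e = rowToColumn := by
      ext1 d
      obtain ⟨x, hx, hx'⟩ := rowToColumn_apply (leftMul e d)
      obtain ⟨y, hy, hy'⟩ := rowToColumn_apply d
      have hxy : x = y := by
        ext n
        rw [hx', hy', column_leftMul, he0]
      exact hx.trans (hxy ▸ hy.symm)
    have h2 : leftMul e * star rowToColumn = star rowToColumn := by
      have h3 := congrArg star h1
      rwa [star_mul, ← leftMul_star, he'.isSelfAdjoint.star_eq] at h3
    have h4 : leftMul e (star rowToColumn c) = star rowToColumn c :=
      congrArg (fun f : HS →L[ℂ] HS => f c) h2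
    have h5 := congrArg (column n) h4
    rw [column_leftMul] at h5
    exact Submodule.starProjection_eq_self_iff.1 h5

/-! ### Distance from the amplified operator to the vector constrained operators -/

/-- Applied to e₀ placed in column l, `rowToColumn` remembers l as the direction e_l. Different
slots of a block therefore receive orthogonal vectors, which is what raises the rank. -/
theorem column_blockAmplification_rowToColumn (l n : ℕ) :
    column l (blockAmplification rowToColumn (putColumn n (stdBasis 0)))
      = if l.unpair.1 = n then (blockWeight l : ℂ) • stdBasis l else 0 := by
  rw [column_blockAmplification, column_putColumn]
  split_ifs
  · obtain ⟨x, hx, hx'⟩ := rowToColumn_apply (putColumn l (stdBasis 0))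
    rw [hx, column_putColumn, if_pos rfl]
    congr 1
    ext m
    rw [hx', column_putColumn, stdBasis_apply]
    split_ifs
    · simp [stdBasis_apply]
    · rfl
  · simp

theorem norm_blockAmplification_rowToColumn (n : ℕ) :
    ‖blockAmplification rowToColumn (putColumn n (stdBasis 0))‖ = 1 := by
  have h1 := hasSum_norm_sq_column (blockAmplification rowToColumn (putColumn n (stdBasis 0)))
  have h2 := hasSum_blockWeight_sq_mul (g := fun m => if m = n then 1 else 0)
    (fun m => by positivity) (hasSum_ite_eq n (1 : ℝ))
  have h3 : ‖blockAmplification rowToColumn (putColumn n (stdBasis 0))‖ ^ 2 = 1 := by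
    refine h1.unique ?_
    convert h2 using 2 with l
    rw [column_blockAmplification_rowToColumn]
    split_ifs
    · rw [norm_smul, norm_stdBasis, Complex.norm_real, Real.norm_eq_abs, mul_one, sq_abs, mul_one]
    · simp
  nlinarith [norm_nonneg (blockAmplification rowToColumn (putColumn n (stdBasis 0)))]

/-- Each column has squared norm at most ‖q e_l‖²/(n + 1) after multiplication by q, and ∑ ‖q e_l‖²
= Tr q. -/
theorem norm_sq_leftMul_blockAmplification_rowToColumn_le {q : EllTwo →L[ℂ] EllTwo}
    (hq : IsStarProjection q) (n : ℕ) :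
    ENNReal.ofReal (‖leftMul q (blockAmplification rowToColumn (putColumn n (stdBasis 0)))‖ ^ 2)
      ≤ ENNReal.ofReal ((n : ℝ) + 1)⁻¹ * stdTrace q := by
  have h := hasSum_norm_sq_column
    (leftMul q (blockAmplification rowToColumn (putColumn n (stdBasis 0))))
  rw [← h.tsum_eq, ENNReal.ofReal_tsum_of_nonneg (fun _ => by positivity) h.summable,
    stdTrace_eq_tsum_norm_sq hq, ← ENNReal.tsum_mul_left]
  refine ENNReal.tsum_le_tsum fun l => ?_
  rw [← ENNReal.ofReal_mul (by positivity), column_leftMul, column_blockAmplification_rowToColumn]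
  refine ENNReal.ofReal_le_ofReal ?_
  split_ifs with hl
  · rw [map_smul, norm_smul, mul_pow, Complex.norm_real, Real.norm_eq_abs, sq_abs, ← hl]
    gcongr
    exact blockWeight_sq_le l
  · rw [map_zero, norm_zero, zero_pow two_ne_zero]
    positivity

theorem stdTrace_support_putColumn_le (n : ℕ) (x : EllTwo) :
    stdTrace (support (putColumn n x)) ≤ 1 := by
  refine stdTrace_support_le_one (x := x) fun m => ?_
  rw [← column_apply, column_putColumn]
  split_ifs
  · exact Submodule.mem_span_singleton_self x
  · exact zero_mem _

/-- Vector constrained operators stay away from the block amplification of `rowToColumn`. -/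
theorem one_fourth_le_norm_sub_of_isVectorConstrained {a : HS →L[ℂ] HS}
    (ha : IsVectorConstrained leftMulAlgebra leftMulTrace a) :
    1 / 4 ≤ ‖blockAmplification rowToColumn - a‖ := by
  obtain ⟨k, hk⟩ := ha
  -- This choice gives k/(n + 1) ≤ 1/16 = (1/4)², the bound needed for the part of u under q.
  obtain ⟨n, hn⟩ := exists_nat_ge (16 * (k : ℝ))
  set ξ : HS := putColumn n (stdBasis 0) with hξ
  have hξ1 : ‖ξ‖ = 1 := by rw [hξ, norm_putColumn, norm_stdBasis]
  set u : HS := blockAmplification rowToColumn ξ with hu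
  have hu1 : ‖u‖ = 1 := norm_blockAmplification_rowToColumn n
  set q := support (a ξ) with hqdef
  have hq : IsStarProjection q := isStarProjection_support _
  have htr : stdTrace q ≤ k :=
    ((hk ξ).1.trans (mul_le_mul_right (stdTrace_support_putColumn_le n _) _)).trans
      (mul_one _).le
  have hqu : ‖leftMul q u‖ ≤ 1 / 4 := by
    refine le_of_sq_le_sq ?_ (by norm_num)
    have h1 := (norm_sq_leftMul_blockAmplification_rowToColumn_le hq n).trans
      (mul_le_mul_right htr _)
    rw [← ENNReal.ofReal_coe_nnreal, ← ENNReal.ofReal_mul (by positivity),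
      ENNReal.ofReal_le_ofReal_iff (by positivity)] at h1
    refine h1.trans ?_
    rw [inv_mul_le_iff₀ (by positivity)]
    linarith
  have hd : ‖u - a ξ‖ ≤ ‖blockAmplification rowToColumn - a‖ := by
    simpa [hξ1] using (blockAmplification rowToColumn - a).le_opNorm ξ
  have hqd : ‖leftMul q (u - a ξ)‖ ≤ ‖u - a ξ‖ :=
    (isStarProjection_leftMul_iff.2 hq).norm_apply_le _
  -- Since q fixes a ξ, the part of u orthogonal to q only sees u - a ξ. The triangle inequality
  -- then gives 1 ≤ 2 ‖u - a ξ‖ + 1/4, which is more than enough.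
  have hsplit : u = (u - a ξ) - leftMul q (u - a ξ) + leftMul q u := by
    rw [map_sub, hqdef, leftMul_support_apply]
    abel
  have h2 : ‖u‖ ≤ ‖u - a ξ‖ + ‖leftMul q (u - a ξ)‖ + ‖leftMul q u‖ := by
    calc ‖u‖ = ‖(u - a ξ) - leftMul q (u - a ξ) + leftMul q u‖ := congrArg _ hsplit
      _ ≤ _ := (norm_add_le _ _).trans (by gcongr; exact norm_sub_le _ _)
  linarith

end HS

/-- The vector support expansion C*-algebra of `B(ℓ²)` acting by left multiplication on the
Hilbert–Schmidt operators is not a quantum uniform Roe algebra: no quantum coarse structure on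
`B(ℓ²) ⊆ B(HS)` gives rise to it. -/
theorem theorem5p13 :
    ¬ ∃ 𝒱 : Set (Set (HS →L[ℂ] HS)),
      IsQuantumCoarseStructure leftMulAlgebra 𝒱 ∧
        quantumUniformRoeAlgebra 𝒱 =
          vectorSupportExpansionAlgebra leftMulAlgebra leftMulTrace := by
  rintro ⟨𝒱, h𝒱, heq⟩
  have hr : HS.rowToColumn ∈ quantumUniformRoeAlgebra 𝒱 :=
    heq ▸ subset_closure HS.isVectorConstrained_rowToColumn
  -- Two strict approximations within 1/8, one before and one after amplification, add up to less
  -- than the forbidden distance 1/4.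
  obtain ⟨v, ⟨V, hV, hv⟩, hrv⟩ := Metric.mem_closure_iff.1 hr (1 / 8) (by norm_num)
  have hT : HS.blockAmplification v ∈ vectorSupportExpansionAlgebra leftMulAlgebra leftMulTrace :=
    heq ▸ subset_closure ⟨V, hV, HS.blockAmplification_mem (h𝒱.isQuantumRelation V hV) hv⟩
  obtain ⟨a, ha, hTa⟩ := Metric.mem_closure_iff.1 hT (1 / 8) (by norm_num)
  have h1 := HS.one_fourth_le_norm_sub_of_isVectorConstrained ha
  have h2 : ‖HS.blockAmplification HS.rowToColumn - HS.blockAmplification v‖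
      ≤ ‖HS.rowToColumn - v‖ := by
    rw [← HS.blockAmplification_sub]
    exact HS.norm_blockAmplification_le _
  have h3 := norm_sub_le_norm_sub_add_norm_sub (HS.blockAmplification HS.rowToColumn)
    (HS.blockAmplification v) a
  rw [dist_eq_norm] at hrv hTa
  linarith
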